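/- Let $(X_t)_{t\ge 0}$ be a continuous-time, time-homogeneous Markov process with countable state space $S$ and transition probabilities $p_t(x,y)$, $x,y\in S$, started in a state $i\in S$. Let $$L_t=\int_0^t \mathbf 1_{\{X_s=i\}}\,ds ,\qquad G_\infty=\int_0^\infty p_t(i,i)\,dt$$ be the local time of $X$ in $i$ and the Green function at $(i,i)$. Suppose that $G_\infty<\infty$ and let $0<\kappa<1/G_\infty$ (with $1/0=\infty$). Then $$\lim_{t\to\infty}\mathbb E\big[e^{\kappa L_t}\big]=\frac{1}{1-\kappa G_\infty}.$$ -/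

import Mathlib

open MeasureTheory ProbabilityTheory Filter Topology
open scoped NNReal ENNReal

/-- A time-homogeneous transition function `p_t(x, ·) = P t x` on `S`: probability kernels with
`p_0 = id` that satisfy the Chapman–Kolmogorov equations. -/
structure IsTransitionFunction {S : Type*} [MeasurableSpace S]
    (P : ℝ≥0 → Kernel S S) : Prop where
  isMarkovKernel : ∀ t, IsMarkovKernel (P t)
  zero : P 0 = Kernel.id
  chapman_kolmogorov : ∀ s t, P (s + t) = P t ∘ₖ P s

/-- The σ-algebra `σ(X_u : u ≤ s)` generated by the process up to time `s`. -/
abbrev pastSigmaAlgebra {S Ω : Type*} [MeasurableSpace S] (X : ℝ≥0 → Ω → S) (s : ℝ≥0) :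
    MeasurableSpace Ω :=
  ⨆ u ∈ Set.Iic s, MeasurableSpace.comap (X u) inferInstance

/-- `X` is, under `μ`, a continuous-time, time-homogeneous Markov process on the countable set `S`
with transition function `P`, started in `i`. The last field is the Markov property
`μ(X_{s+t} = y | σ(X_u : u ≤ s)) = p_t(X_s, y)`, written on the atoms `{X_s = x}`.
Right-continuous paths imply the joint measurability that is asked for. -/
structure IsMarkovProcessFrom {S Ω : Type*} [MeasurableSpace S] [MeasurableSpace Ω]
    (P : ℝ≥0 → Kernel S S) (μ : Measure Ω) (i : S) (X : ℝ≥0 → Ω → S) : Prop where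
  transition : IsTransitionFunction P
  measurable : Measurable (Function.uncurry X)
  start : ∀ᵐ ω ∂μ, X 0 ω = i
  markov : ∀ (s t : ℝ≥0) (A : Set Ω), MeasurableSet[pastSigmaAlgebra X s] A → ∀ x y : S,
    μ (A ∩ {ω | X s ω = x} ∩ {ω | X (s + t) ω = y}) = μ (A ∩ {ω | X s ω = x}) * P t x {y}

/-- The Green function on the diagonal, `G_∞(i,i) = ∫_0^∞ p_t(i,i) dt`. -/
noncomputable def greenDiag {S : Type*} [MeasurableSpace S] (P : ℝ≥0 → Kernel S S) (i : S) :
    ℝ≥0∞ :=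
  ∫⁻ t in Set.Ioi (0 : ℝ), P t.toNNReal i {i}

/-- The local time in `i` up to time `t`, `L_t = ∫_0^t δ_i(X_s) ds`, where `δ_i(x)` is `1` for
`x = i` and `0` otherwise. -/
noncomputable def localTime {S Ω : Type*} (X : ℝ≥0 → Ω → S) (i : S) (t : ℝ) (ω : Ω) : ℝ :=
  ∫ s in (0 : ℝ)..t, Set.indicator {i} (fun _ => (1 : ℝ)) (X s.toNNReal ω)

/-! The total time $L_\infty$ in $i$ has the moments $n!\,G_\infty^n$ of an exponential law.
Ordering the $n+1$ time variables of a power by their largest gives $L_t^{n+1} = (n+1)\int_0^t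
\mathbf 1_{\{X_u=i\}} L_u^n\,du$, an instance of `measure_univ_pow_succ_eq_lintegral`. Conditioning
at the time $u$ of a visit (`setLIntegral_markov`) splits off a factor $p_{s-u}(i,i)$, which Tonelli
integrates to $G_\infty$; this recursion is `lintegral_visit_mul_occupationTime_pow`. Summing the
exponential series then gives a geometric series in $\kappa G_\infty$, and $e^{\kappa L_\infty}$
dominates the passage $t\to\infty$. -/

/-- For an atomless measure `ν` on the line, `ν(ℝ)ⁿ⁺¹ = (n + 1) ∫ ν((-∞, u])ⁿ dν(u)`. -/
theorem measure_univ_pow_succ_eq_lintegral (n : ℕ) :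
    ∀ (ν : Measure ℝ) [SFinite ν] [NullSingletonClass ν],
      ν Set.univ ^ (n + 1) = (n + 1) * ∫⁻ u, ν (Set.Iic u) ^ n ∂ν := by
  induction n with
  | zero => intro ν _ _; simp
  | succ n ih =>
    intro ν _ _
    have hmono : Monotone fun u => ν (Set.Iic u) := fun a b hab =>
      measure_mono (Set.Iic_subset_Iic.2 hab)
    have hmeas : Measurable fun u => ν (Set.Iic u) := hmono.measurable
    have hmeas' : Measurable fun u => ν (Set.Ioi u) :=
      Antitone.measurable fun a b hab => measure_mono (Set.Ioi_subset_Ioi hab)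
    -- The induction hypothesis is used for `ν` restricted to a half-line, hence the quantification
    -- over measures; having no atoms makes the endpoint irrelevant.
    have hloc (v : ℝ) : (n + 1 : ℝ≥0∞) * ∫⁻ u in Set.Iio v, ν (Set.Iic u) ^ n ∂ν
        = ν (Set.Iic v) ^ (n + 1) := by
      have h := ih (ν.restrict (Set.Iic v))
      rw [Measure.restrict_apply_univ] at h
      rw [h, Measure.restrict_congr_set Iio_ae_eq_Iic]
      congr 1
      refine setLIntegral_congr_fun measurableSet_Iic fun u hu => ?_
      rw [Measure.restrict_apply measurableSet_Iic, Set.inter_eq_left.2 (Set.Iic_subset_Iic.2 hu)]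
    have hswap : ∫⁻ u, ν (Set.Iic u) ^ n * ν (Set.Ioi u) ∂ν
        = ∫⁻ v, ∫⁻ u in Set.Iio v, ν (Set.Iic u) ^ n ∂ν ∂ν := by
      have h1 (u : ℝ) : ν (Set.Iic u) ^ n * ν (Set.Ioi u)
          = ∫⁻ v, {q : ℝ × ℝ | q.1 < q.2}.indicator (fun q => ν (Set.Iic q.1) ^ n) (u, v) ∂ν := by
        rw [← setLIntegral_const, ← lintegral_indicator measurableSet_Ioi]
        rfl
      have h2 (v : ℝ) : ∫⁻ u in Set.Iio v, ν (Set.Iic u) ^ n ∂ν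
          = ∫⁻ u, {q : ℝ × ℝ | q.1 < q.2}.indicator (fun q => ν (Set.Iic q.1) ^ n) (u, v) ∂ν := by
        rw [← lintegral_indicator measurableSet_Iio]
        rfl
      simp_rw [h1, h2]
      refine lintegral_lintegral_swap (Measurable.aemeasurable ?_)
      exact ((hmeas.comp measurable_fst).pow_const n).indicator
        (measurableSet_lt measurable_fst measurable_snd)
    have hsum (u : ℝ) : ν (Set.Iic u) ^ n * ν Set.univ
        = ν (Set.Iic u) ^ (n + 1) + ν (Set.Iic u) ^ n * ν (Set.Ioi u) := by
      rw [← Set.compl_Iic, pow_succ, ← mul_add, measure_add_measure_compl measurableSet_Iic]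
    calc ν Set.univ ^ (n + 1 + 1)
        = (n + 1) * ∫⁻ u, ν (Set.Iic u) ^ n * ν Set.univ ∂ν := by
          rw [pow_succ, ih ν, lintegral_mul_const _ (hmeas.pow_const n), mul_assoc]
      _ = (n + 1) * ∫⁻ u, ν (Set.Iic u) ^ (n + 1) ∂ν
          + ∫⁻ v, (n + 1) * ∫⁻ u in Set.Iio v, ν (Set.Iic u) ^ n ∂ν ∂ν := by
          simp_rw [hsum]
          rw [lintegral_add_left (hmeas.pow_const _), mul_add, hswap,
            lintegral_const_mul' _ _ (by finiteness)]
      _ = (↑(n + 1) + 1) * ∫⁻ u, ν (Set.Iic u) ^ (n + 1) ∂ν := by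
          simp_rw [hloc]
          push_cast
          ring

/-! ### Occupation times along a path -/

section Occupation

variable {S Ω : Type*}

/-- The indicator of the event `X_s = i`, with values in `ℝ≥0∞`. -/
noncomputable def visit (X : ℝ≥0 → Ω → S) (i : S) (s : ℝ) (ω : Ω) : ℝ≥0∞ :=
  Set.indicator {i} (fun _ => (1 : ℝ≥0∞)) (X s.toNNReal ω)

/-- The time spent in `i` up to time `t`, with values in `ℝ≥0∞`. -/
noncomputable def occupationTime (X : ℝ≥0 → Ω → S) (i : S) (t : ℝ) (ω : Ω) : ℝ≥0∞ :=
  ∫⁻ s in Set.Ioc 0 t, visit X i s ω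

/-- The total time spent in `i`, with values in `ℝ≥0∞`. -/
noncomputable def totalOccupationTime (X : ℝ≥0 → Ω → S) (i : S) (ω : Ω) : ℝ≥0∞ :=
  ∫⁻ s in Set.Ioi (0 : ℝ), visit X i s ω

theorem visit_le_one (X : ℝ≥0 → Ω → S) (i : S) (s : ℝ) (ω : Ω) : visit X i s ω ≤ 1 :=
  Set.indicator_le_self' (by simp) _

theorem occupationTime_le_total (X : ℝ≥0 → Ω → S) (i : S) (t : ℝ) (ω : Ω) :
    occupationTime X i t ω ≤ totalOccupationTime X i ω :=
  lintegral_mono_set Set.Ioc_subset_Ioi_self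

theorem tendsto_occupationTime (X : ℝ≥0 → Ω → S) (i : S) (ω : Ω) :
    Tendsto (fun t => occupationTime X i t ω) atTop (𝓝 (totalOccupationTime X i ω)) := by
  set ν := (volume.restrict (Set.Ioi (0 : ℝ))).withDensity fun s => visit X i s ω with hν
  have h1 (t : ℝ) : occupationTime X i t ω = ν (Set.Iic t) := by
    rw [hν, withDensity_apply _ measurableSet_Iic, Measure.restrict_restrict measurableSet_Iic,
      Set.inter_comm, Set.Ioi_inter_Iic, occupationTime]
  have h2 : totalOccupationTime X i ω = ν Set.univ := by
    rw [hν, withDensity_apply _ .univ, Measure.restrict_univ, totalOccupationTime]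
  simp_rw [h1, h2]
  exact tendsto_measure_Iic_atTop ν

theorem IsMarkovProcessFrom.measure_eq [MeasurableSpace S] [MeasurableSpace Ω]
    {P : ℝ≥0 → Kernel S S} {μ : Measure Ω}
    [IsProbabilityMeasure μ] {i : S} {X : ℝ≥0 → Ω → S} (hX : IsMarkovProcessFrom P μ i X) (s : ℝ≥0)
    (y : S) :
    μ {ω | X s ω = y} = P s i {y} := by
  have h := hX.markov 0 s Set.univ .univ i y
  have h0 : {ω | X 0 ω = i} =ᵐ[μ] Set.univ := eventuallyEq_univ.2 hX.start
  rw [Set.univ_inter, zero_add, measure_congr h0, measure_univ, one_mul] at h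
  rw [← h]
  exact measure_congr (inter_ae_eq_right_of_ae_eq_univ h0).symm

variable [MeasurableSpace S] [DiscreteMeasurableSpace S] [MeasurableSpace Ω]
  {X : ℝ≥0 → Ω → S}

theorem measurable_visit (hX : Measurable (Function.uncurry X)) (i : S) :
    Measurable (Function.uncurry (visit X i)) := by
  have h : Measurable (Set.indicator {i} (fun _ : S => (1 : ℝ≥0∞))) := .of_discrete
  exact h.comp (hX.comp (measurable_real_toNNReal.prodMap measurable_id))

theorem measurable_visit_time (hX : Measurable (Function.uncurry X)) (i : S) (ω : Ω) :
    Measurable fun s => visit X i s ω :=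
  (measurable_visit hX i).comp measurable_prodMk_right

theorem measurable_visit_path (hX : Measurable (Function.uncurry X)) (i : S) (s : ℝ) :
    Measurable (visit X i s) :=
  (measurable_visit hX i).comp measurable_prodMk_left

theorem measurable_occupationTime (hX : Measurable (Function.uncurry X)) (i : S) :
    Measurable (Function.uncurry (occupationTime X i)) := by
  have h (q : ℝ × Ω) : Function.uncurry (occupationTime X i) q
      = ∫⁻ s, {r : (ℝ × Ω) × ℝ | 0 < r.2 ∧ r.2 ≤ r.1.1}.indicator
          (fun r => visit X i r.2 r.1.2) (q, s) := by
    rw [Function.uncurry, occupationTime, ← lintegral_indicator measurableSet_Ioc]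
    rfl
  rw [funext h]
  refine Measurable.lintegral_prod_right' (f := {r : (ℝ × Ω) × ℝ | 0 < r.2 ∧ r.2 ≤ r.1.1}.indicator
          (fun r => visit X i r.2 r.1.2)) (Measurable.indicator ?_ ?_)
  · exact (measurable_visit hX i).comp (measurable_snd.prodMk (measurable_snd.comp measurable_fst))
  · exact (measurableSet_lt measurable_const measurable_snd).inter
      (measurableSet_le measurable_snd (measurable_fst.comp measurable_fst))

theorem measurable_occupationTime_path (hX : Measurable (Function.uncurry X)) (i : S) (t : ℝ) :
    Measurable (occupationTime X i t) :=
  (measurable_occupationTime hX i).comp measurable_prodMk_left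

theorem measurable_totalOccupationTime (hX : Measurable (Function.uncurry X)) (i : S) :
    Measurable (totalOccupationTime X i) :=
  (measurable_visit hX i).lintegral_prod_left'

/-- For negative `t` this can fail: the interval integral changes sign, while the occupation time is
zero. -/
theorem localTime_eq_toReal (hX : Measurable (Function.uncurry X)) (i : S) {t : ℝ} (ht : 0 ≤ t)
    (ω : Ω) : localTime X i t ω = (occupationTime X i t ω).toReal := by
  have h (s : ℝ) : Set.indicator {i} (fun _ => (1 : ℝ)) (X s.toNNReal ω)
      = (visit X i s ω).toReal := by
    by_cases hs : X s.toNNReal ω = i <;> simp [visit, hs]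
  rw [localTime, intervalIntegral.integral_of_le ht]
  simp_rw [h]
  exact integral_toReal (measurable_visit_time hX i ω).aemeasurable
    (ae_of_all _ fun s => (visit_le_one X i s ω).trans_lt ENNReal.one_lt_top)

/-- The measure with density `visit` along the path is atomless, and its distribution function is
the occupation time. -/
theorem totalOccupationTime_pow_succ (hX : Measurable (Function.uncurry X)) (i : S) (n : ℕ)
    (ω : Ω) : totalOccupationTime X i ω ^ (n + 1)
      = (n + 1) * ∫⁻ u in Set.Ioi (0 : ℝ), visit X i u ω * occupationTime X i u ω ^ n := by
  have hv := measurable_visit_time hX i ω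
  set ν := (volume.restrict (Set.Ioi (0 : ℝ))).withDensity fun s => visit X i s ω with hν
  have h1 (t : ℝ) : ν (Set.Iic t) = occupationTime X i t ω := by
    rw [hν, withDensity_apply _ measurableSet_Iic, Measure.restrict_restrict measurableSet_Iic,
      Set.inter_comm, Set.Ioi_inter_Iic, occupationTime]
  have h2 : ν Set.univ = totalOccupationTime X i ω := by
    rw [hν, withDensity_apply _ .univ, Measure.restrict_univ, totalOccupationTime]
  rw [← h2, measure_univ_pow_succ_eq_lintegral n ν]
  simp_rw [h1]
  have hL : Measurable fun u => occupationTime X i u ω :=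
    (measurable_occupationTime hX i).comp measurable_prodMk_right
  rw [hν, lintegral_withDensity_eq_lintegral_mul _ hv (hL.pow_const n)]
  rfl

theorem occupationTime_pow_succ (hX : Measurable (Function.uncurry X)) (i : S) (n : ℕ) (t : ℝ)
    (ω : Ω) : occupationTime X i t ω ^ (n + 1)
      = (n + 1) * ∫⁻ u in Set.Ioc 0 t, visit X i u ω * occupationTime X i u ω ^ n := by
  have hv := measurable_visit_time hX i ω
  set ν := (volume.restrict (Set.Ioc (0 : ℝ) t)).withDensity fun s => visit X i s ω with hν
  have h2 : ν Set.univ = occupationTime X i t ω := by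
    rw [hν, withDensity_apply _ .univ, Measure.restrict_univ, occupationTime]
  have hmono : Monotone fun u => ν (Set.Iic u) := fun a b hab =>
    measure_mono (Set.Iic_subset_Iic.2 hab)
  rw [← h2, measure_univ_pow_succ_eq_lintegral n ν]
  nth_rw 2 [hν]
  rw [lintegral_withDensity_eq_lintegral_mul _ hv (hmono.measurable.pow_const n)]
  congr 1
  refine setLIntegral_congr_fun measurableSet_Ioc fun u hu => ?_
  simp only [Pi.mul_apply]
  rw [hν, withDensity_apply _ measurableSet_Iic, Measure.restrict_restrict measurableSet_Iic,
    Set.inter_comm, Set.Ioc_inter_Iic, min_eq_right hu.2, occupationTime]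

theorem setLIntegral_visit_mul {μ : Measure Ω} (hX : Measurable (Function.uncurry X)) (i : S)
    (A : Set Ω) (s : ℝ) (f : Ω → ℝ≥0∞) :
    ∫⁻ ω in A, visit X i s ω * f ω ∂μ = ∫⁻ ω in A ∩ {ω | X s.toNNReal ω = i}, f ω ∂μ := by
  have hs : MeasurableSet {ω | X s.toNNReal ω = i} :=
    (hX.comp measurable_prodMk_left) (measurableSet_singleton i)
  rw [Set.inter_comm, ← Measure.restrict_restrict hs, ← lintegral_indicator hs]
  refine lintegral_congr fun ω => ?_
  by_cases h : X s.toNNReal ω = i <;> simp [visit, h]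

/-- Weighting by a further factor of the occupation time amounts to integrating over the times at
which one conditions on a visit. -/
theorem setLIntegral_occupationTime_pow_succ_mul {μ : Measure Ω} [SFinite μ]
    (hX : Measurable (Function.uncurry X)) (i : S) (A : Set Ω) (u : ℝ) (n : ℕ) {f : Ω → ℝ≥0∞}
    (hf : Measurable f) :
    ∫⁻ ω in A, occupationTime X i u ω ^ (n + 1) * f ω ∂μ
      = ∫⁻ v in Set.Ioc 0 u, ∫⁻ ω in A ∩ {ω | X v.toNNReal ω = i},
          occupationTime X i u ω ^ n * f ω ∂μ := by
  have hg : Measurable fun ω => occupationTime X i u ω ^ n * f ω :=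
    ((measurable_occupationTime_path hX i u).pow_const n).mul hf
  simp_rw [← setLIntegral_visit_mul hX]
  rw [lintegral_lintegral_swap (Measurable.aemeasurable
    ((measurable_visit hX i).mul (hg.comp measurable_snd)))]
  refine lintegral_congr fun ω => ?_
  rw [lintegral_mul_const _ (measurable_visit_time hX i ω), pow_succ', mul_assoc]
  rfl

/-! ### Markov property and moments -/

variable {P : ℝ≥0 → Kernel S S} {μ : Measure Ω} [IsProbabilityMeasure μ] {i : S}

theorem IsMarkovProcessFrom.measurable_transition (hX : IsMarkovProcessFrom P μ i X) :
    Measurable fun s : ℝ => P s.toNNReal i {i} := by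
  have h := (measurable_visit hX.measurable i).lintegral_prod_right' (ν := μ)
  refine (congrArg Measurable (funext fun s => ?_)).mp h
  simpa [hX.measure_eq] using setLIntegral_visit_mul (μ := μ) hX.measurable i .univ s 1

/-- The Markov property is given for events only. Each factor of the occupation time becomes an
integral over $v\le u$ of a restriction to $\{X_v=i\}$, a past event that is absorbed into `A`; so
the induction must run over all `A`. -/
theorem IsMarkovProcessFrom.setLIntegral_markov (hX : IsMarkovProcessFrom P μ i X) {u s : ℝ}
    (hu : 0 ≤ u) (hus : u ≤ s) (n : ℕ) : ∀ A : Set Ω,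
    MeasurableSet[pastSigmaAlgebra X u.toNNReal] A →
      ∫⁻ ω in A, occupationTime X i u ω ^ n * (visit X i u ω * visit X i s ω) ∂μ
        = (∫⁻ ω in A, occupationTime X i u ω ^ n * visit X i u ω ∂μ)
          * P (s - u).toNNReal i {i} := by
  have hmu := measurable_visit_path hX.measurable i u
  have hms := measurable_visit_path hX.measurable i s
  induction n with
  | zero =>
    intro A hA
    have h1 (B : Set Ω) (r : ℝ) : ∫⁻ ω in B, visit X i r ω ∂μ
        = μ (B ∩ {ω | X r.toNNReal ω = i}) := by
      simpa using setLIntegral_visit_mul (μ := μ) hX.measurable i B r 1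
    have hm := hX.markov u.toNNReal (s - u).toNNReal A hA i i
    rw [← Real.toNNReal_add hu (sub_nonneg.2 hus), add_sub_cancel] at hm
    simp only [pow_zero, one_mul]
    rw [setLIntegral_visit_mul hX.measurable, h1, h1, hm]
  | succ n ih =>
    intro A hA
    rw [setLIntegral_occupationTime_pow_succ_mul hX.measurable i A u n
        (f := fun ω => visit X i u ω * visit X i s ω) (hmu.mul hms),
      setLIntegral_occupationTime_pow_succ_mul hX.measurable i A u n hmu,
      ← lintegral_mul_const']
    · refine setLIntegral_congr_fun measurableSet_Ioc fun v hv => ih _ (hA.inter ?_)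
      have hle : MeasurableSpace.comap (X v.toNNReal) inferInstance
          ≤ pastSigmaAlgebra X u.toNNReal :=
        le_iSup₂_of_le v.toNNReal (Real.toNNReal_le_toNNReal hv.2) le_rfl
      exact hle _ ⟨{i}, measurableSet_singleton i, rfl⟩
    · have := hX.transition.isMarkovKernel (s - u).toNNReal
      finiteness

theorem IsMarkovProcessFrom.lintegral_visit_mul_occupationTime_pow
    (hX : IsMarkovProcessFrom P μ i X) (n : ℕ) :
    ∫⁻ s in Set.Ioi (0 : ℝ), ∫⁻ ω, visit X i s ω * occupationTime X i s ω ^ n ∂μ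
      = n.factorial * greenDiag P i ^ (n + 1) := by
  have hv := measurable_visit hX.measurable i
  have hL := measurable_occupationTime hX.measurable i
  induction n with
  | zero =>
    simp only [pow_zero, mul_one, Nat.factorial_zero, Nat.cast_one, one_mul, zero_add, pow_one]
    rw [greenDiag]
    refine lintegral_congr fun s => ?_
    have := setLIntegral_visit_mul (μ := μ) hX.measurable i .univ s 1
    simpa [hX.measure_eq] using this
  | succ n ih =>
    set m : ℝ → ℝ≥0∞ := fun u => ∫⁻ ω, visit X i u ω * occupationTime X i u ω ^ n ∂μ with hm
    have hmm : Measurable m := (hv.mul (hL.pow_const n)).lintegral_prod_right'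
    have hp := hX.measurable_transition
    have h1 (s : ℝ) : ∫⁻ ω, visit X i s ω * occupationTime X i s ω ^ (n + 1) ∂μ
        = (n + 1) * ∫⁻ u in Set.Ioc 0 s, m u * P (s - u).toNNReal i {i} := by
      calc _ = ∫⁻ ω, (n + 1) * (∫⁻ u in Set.Ioc 0 s,
            occupationTime X i u ω ^ n * (visit X i u ω * visit X i s ω)) ∂μ := by
            refine lintegral_congr fun ω => ?_
            rw [occupationTime_pow_succ hX.measurable, mul_left_comm, ← lintegral_const_mul']
            · congr 1
              refine lintegral_congr fun u => ?_
              ring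
            · exact ne_top_of_le_ne_top ENNReal.one_ne_top (visit_le_one X i s ω)
        _ = _ := by
            have hmeas : Measurable (Function.uncurry fun (ω : Ω) (u : ℝ) =>
                occupationTime X i u ω ^ n * (visit X i u ω * visit X i s ω)) :=
              ((hL.comp measurable_swap).pow_const n).mul ((hv.comp measurable_swap).mul
                ((measurable_visit_path hX.measurable i s).comp measurable_fst))
            rw [lintegral_const_mul' _ _ (by finiteness),
              lintegral_lintegral_swap hmeas.aemeasurable]
            congr 1
            refine setLIntegral_congr_fun measurableSet_Ioc fun u hu => ?_
            have := hX.setLIntegral_markov hu.1.le hu.2 n .univ .univ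
            simp only [Measure.restrict_univ] at this
            rw [this]
            simp only [hm, mul_comm (visit X i u _)]
    have hshift (u : ℝ) : ∫⁻ s in Set.Ici u, P (s - u).toNNReal i {i} = greenDiag P i := by
      rw [greenDiag, ← lintegral_indicator measurableSet_Ioi,
        setLIntegral_congr Ioi_ae_eq_Ici.symm,
        ← lintegral_indicator measurableSet_Ioi,
        ← lintegral_sub_right_eq_self ((Set.Ioi 0).indicator _) u]
      refine lintegral_congr fun s => ?_
      simp [Set.indicator, sub_pos]
    -- Swapping the order of integration decouples the convolution: for fixed `u`, the integral over
    -- `s` is the Green function.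
    have hswap : ∫⁻ s in Set.Ioi (0 : ℝ), ∫⁻ u in Set.Ioc 0 s, m u * P (s - u).toNNReal i {i}
        = ∫⁻ u in Set.Ioi (0 : ℝ), ∫⁻ s in Set.Ici u, m u * P (s - u).toNNReal i {i} := by
      set T : Set (ℝ × ℝ) := {q | 0 < q.2 ∧ q.2 ≤ q.1}
      set F : ℝ × ℝ → ℝ≥0∞ := T.indicator fun q => m q.2 * P (q.1 - q.2).toNNReal i {i}
      have hF : Measurable F := by
        refine Measurable.indicator ?_ ?_
        · exact (hmm.comp measurable_snd).mul (hp.comp (measurable_fst.sub measurable_snd))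
        · exact (measurableSet_lt measurable_const measurable_snd).inter
            (measurableSet_le measurable_snd measurable_fst)
      calc _ = ∫⁻ s, ∫⁻ u, F (s, u) := by
            rw [← lintegral_indicator measurableSet_Ioi]
            refine lintegral_congr fun s => ?_
            by_cases hs : 0 < s
            · rw [Set.indicator_of_mem (Set.mem_Ioi.2 hs), ← lintegral_indicator measurableSet_Ioc]
              rfl
            · rw [Set.indicator_of_notMem (by simpa using hs)]
              have (u : ℝ) : F (s, u) = 0 :=
                Set.indicator_of_notMem (fun h => hs (h.1.trans_le h.2)) _
              simp [this]
        _ = ∫⁻ u, ∫⁻ s, F (s, u) := lintegral_lintegral_swap hF.aemeasurable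
        _ = _ := by
            rw [← lintegral_indicator measurableSet_Ioi]
            refine lintegral_congr fun u => ?_
            by_cases hu : 0 < u
            · rw [Set.indicator_of_mem (Set.mem_Ioi.2 hu), ← lintegral_indicator measurableSet_Ici]
              refine lintegral_congr fun s => ?_
              simp [F, T, Set.indicator, hu]
            · rw [Set.indicator_of_notMem (by simpa using hu)]
              have (s : ℝ) : F (s, u) = 0 := Set.indicator_of_notMem (fun h => hu h.1) _
              simp [this]
    simp_rw [h1]
    rw [lintegral_const_mul' _ _ (by finiteness), hswap]
    have hinner (u : ℝ) : ∫⁻ s in Set.Ici u, m u * P (s - u).toNNReal i {i}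
        = m u * greenDiag P i := by
      have h : Measurable fun s => P (s - u).toNNReal i {i} := hp.comp (measurable_id.sub_const u)
      rw [lintegral_const_mul _ h, hshift]
    simp_rw [hinner]
    rw [lintegral_mul_const _ hmm, ih, Nat.factorial_succ, pow_succ _ (n + 1)]
    push_cast
    ring

/-- The moments of the total occupation time are those of an exponential law with mean the Green
function. -/
theorem IsMarkovProcessFrom.lintegral_totalOccupationTime_pow
    (hX : IsMarkovProcessFrom P μ i X) (n : ℕ) :
    ∫⁻ ω, totalOccupationTime X i ω ^ n ∂μ = n.factorial * greenDiag P i ^ n := by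
  cases n with
  | zero => simp
  | succ n =>
    have hmeas : Measurable (Function.uncurry fun (ω : Ω) (u : ℝ) =>
        visit X i u ω * occupationTime X i u ω ^ n) :=
      ((measurable_visit hX.measurable i).comp measurable_swap).mul
        (((measurable_occupationTime hX.measurable i).comp measurable_swap).pow_const n)
    simp_rw [totalOccupationTime_pow_succ hX.measurable]
    rw [lintegral_const_mul' _ _ (by finiteness), lintegral_lintegral_swap hmeas.aemeasurable,
      hX.lintegral_visit_mul_occupationTime_pow, Nat.factorial_succ]
    push_cast
    ring

/-! ### Exponential moment and limit -/

theorem IsMarkovProcessFrom.totalOccupationTime_ae_lt_top (hX : IsMarkovProcessFrom P μ i X)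
    (hG : greenDiag P i < ∞) : ∀ᵐ ω ∂μ, totalOccupationTime X i ω < ∞ := by
  refine ae_lt_top (measurable_totalOccupationTime hX.measurable i) ?_
  have h := hX.lintegral_totalOccupationTime_pow 1
  simp only [pow_one, Nat.factorial_one, Nat.cast_one, one_mul] at h
  rw [h]
  exact hG.ne

/-- All terms are nonnegative, so sum and integral commute freely. No bound on `κ` from above is
needed: once $\kappa G_\infty\ge 1$, both sides are infinite. -/
theorem IsMarkovProcessFrom.lintegral_exp_totalOccupationTime (hX : IsMarkovProcessFrom P μ i X)
    (hG : greenDiag P i < ∞) {κ : ℝ} (hκ : 0 ≤ κ) :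
    ∫⁻ ω, ENNReal.ofReal (Real.exp (κ * (totalOccupationTime X i ω).toReal)) ∂μ
      = (1 - ENNReal.ofReal κ * greenDiag P i)⁻¹ := by
  have hmeas := measurable_totalOccupationTime hX.measurable i
  calc _ = ∫⁻ ω, ∑' n : ℕ, (ENNReal.ofReal κ ^ n / n.factorial)
        * totalOccupationTime X i ω ^ n ∂μ := by
        refine lintegral_congr_ae ?_
        filter_upwards [hX.totalOccupationTime_ae_lt_top hG] with ω hω
        set x := (totalOccupationTime X i ω).toReal
        have hx : totalOccupationTime X i ω = ENNReal.ofReal x := (ENNReal.ofReal_toReal hω.ne).symm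
        have hx0 : 0 ≤ x := ENNReal.toReal_nonneg
        have hs : HasSum (fun n : ℕ => (κ * x) ^ n / n.factorial) (Real.exp (κ * x)) := by
          rw [Real.exp_eq_exp_ℝ]
          exact NormedSpace.expSeries_div_hasSum_exp (κ * x)
        rw [← hs.tsum_eq, ENNReal.ofReal_tsum_of_nonneg (fun n => by positivity) hs.summable]
        refine tsum_congr fun n => ?_
        rw [hx, ENNReal.ofReal_div_of_pos (by positivity), ENNReal.ofReal_pow (by positivity),
          ENNReal.ofReal_mul hκ, mul_pow, ENNReal.ofReal_natCast, div_eq_mul_inv, div_eq_mul_inv]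
        ring
    _ = ∑' n : ℕ, (ENNReal.ofReal κ * greenDiag P i) ^ n := by
        rw [lintegral_tsum fun n => ((hmeas.pow_const n).const_mul _).aemeasurable]
        refine tsum_congr fun n => ?_
        rw [lintegral_const_mul _ (hmeas.pow_const n), hX.lintegral_totalOccupationTime_pow,
          ← mul_assoc, ENNReal.div_mul_cancel (by positivity) (by finiteness), mul_pow]
    _ = _ := ENNReal.tsum_geometric _

end Occupation

theorem mainTheorem8 {S : Type*} [Countable S] [MeasurableSpace S] [DiscreteMeasurableSpace S]
    {Ω : Type*} [MeasurableSpace Ω] (μ : Measure Ω) [IsProbabilityMeasure μ]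
    (P : ℝ≥0 → Kernel S S) (i : S) (X : ℝ≥0 → Ω → S) (hX : IsMarkovProcessFrom P μ i X)
    (hG : greenDiag P i < ∞) (κ : ℝ) (hκ : 0 < κ)
    (hκG : ENNReal.ofReal κ < 1 / greenDiag P i) :
    Tendsto (fun t : ℝ => ∫ ω, Real.exp (κ * localTime X i t ω) ∂μ) atTop
      (𝓝 (1 / (1 - κ * (greenDiag P i).toReal))) := by
  have hlt : ENNReal.ofReal κ * greenDiag P i < 1 := by
    rcases eq_or_ne (greenDiag P i) 0 with h0 | h0
    · simp [h0]
    · exact (ENNReal.lt_div_iff_mul_lt (.inl h0) (.inl hG.ne)).1 hκG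
  have hmeas : Measurable fun ω => Real.exp (κ * (totalOccupationTime X i ω).toReal) :=
    Real.measurable_exp.comp
      ((measurable_totalOccupationTime hX.measurable i).ennreal_toReal.const_mul κ)
  have hexp := hX.lintegral_exp_totalOccupationTime hG hκ.le
  have hlim : ∫ ω, Real.exp (κ * (totalOccupationTime X i ω).toReal) ∂μ
      = 1 / (1 - κ * (greenDiag P i).toReal) := by
    rw [integral_eq_lintegral_of_nonneg_ae (ae_of_all _ fun ω => (Real.exp_pos _).le)
      hmeas.aestronglyMeasurable, hexp, ENNReal.toReal_inv,
      ENNReal.toReal_sub_of_le hlt.le ENNReal.one_ne_top, ENNReal.toReal_mul,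
      ENNReal.toReal_ofReal hκ.le, ENNReal.toReal_one, one_div]
  rw [← hlim]
  refine tendsto_integral_filter_of_dominated_convergence
    (fun ω => Real.exp (κ * (totalOccupationTime X i ω).toReal)) ?_ ?_ ?_ ?_
  · filter_upwards [eventually_ge_atTop 0] with t ht
    simp_rw [localTime_eq_toReal hX.measurable i ht]
    exact (Real.measurable_exp.comp ((measurable_occupationTime_path hX.measurable i
      t).ennreal_toReal.const_mul κ)).aestronglyMeasurable
  · filter_upwards [eventually_ge_atTop 0] with t ht
    filter_upwards [hX.totalOccupationTime_ae_lt_top hG] with ω hω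
    rw [localTime_eq_toReal hX.measurable i ht, Real.norm_of_nonneg (Real.exp_pos _).le]
    have := ENNReal.toReal_mono hω.ne (occupationTime_le_total X i t ω)
    gcongr
  · refine ⟨hmeas.aestronglyMeasurable, ?_⟩
    -- Here the strict inequality $\kappa G_\infty<1$ makes the dominating function integrable.
    rw [hasFiniteIntegral_iff_ofReal (ae_of_all _ fun ω => (Real.exp_pos _).le), hexp]
    exact ENNReal.inv_lt_top.2 (tsub_pos_of_lt hlt)
  · filter_upwards [hX.totalOccupationTime_ae_lt_top hG] with ω hω
    have h := (ENNReal.tendsto_toReal hω.ne).comp (tendsto_occupationTime X i ω)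
    refine ((Real.continuous_exp.tendsto _).comp (h.const_mul κ)).congr' ?_
    filter_upwards [eventually_ge_atTop 0] with t ht
    simp [localTime_eq_toReal hX.measurable i ht]
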